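/- Let $K$ be a number field with ring of integers $\mathcal{O}_K$ and algebraic closure $\overline{K}$. Let $d>m\geq 2$ be integers, let $b,x_0\in K$ with $x_0\neq 0$, and suppose there is a (nonzero) prime $\mathfrak{p}$ of $\mathcal{O}_K$, with normalized additive valuation $v_{\mathfrak{p}}$, such that $\mathfrak{p}\nmid (d-m)$ and $v_{\mathfrak{p}}(b)<\min\{v_{\mathfrak{p}}(x_0),0\}$, with $(d-m)\mid v_{\mathfrak{p}}(b)$ and $\gcd(m,v_{\mathfrak{p}}(x_0/b))=1$. Let $f(x)=x^d-bx^m$, let $n\geq 0$, and let $\alpha\in f^{-n}(x_0)=\{\gamma\in\overline{K} : f^n(\gamma)=x_0\}$, where $f^n$ denotes the $n$-fold composition of $f$ with itself and $f^0(x)=x$. Suppose that $f^n(x)-x_0\in K[x]$ is irreducible over $K$. Then there are a prime $\mathfrak{P}$ of $K(\alpha)$ lying above $\mathfrak{p}$ and a prime $\mathfrak{Q}$ of $K(f^{-1}(\alpha))$, where $f^{-1}(\alpha)=\{\gamma\in\overline{K} : f(\gamma)=\alpha\}$, such that * $\mathfrak{P}$ has ramification index $m^n$ over $\mathfrak{p}$;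 * $m^n v_{\mathfrak{P}}(\alpha/b)$ is a positive integer relatively prime to $m$, where $v_{\mathfrak{P}}$ is the ($\mathbb{Q}$-valued) $\mathfrak{P}$-adic valuation on $K(\alpha)$ extending $v_{\mathfrak{p}}$; * $\mathfrak{Q}$ lies above $\mathfrak{P}$; * $f(x)-\alpha$ has $d$ distinct roots, and the inertia group $I(\mathfrak{Q}\mid\mathfrak{P})=\{\sigma\in\mathrm{Gal}(K(f^{-1}(\alpha))/K(\alpha)) : \sigma(x)\equiv x \pmod{\mathfrak{Q}} \text{ for all integers } x \text{ of } K(f^{-1}(\alpha))\}$ acts transitively on $m$ of these roots and fixes each of the other $d-m$ roots. -/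

import Mathlib

open NumberField IntermediateField Polynomial IsDedekindDomain

/-- The additive valuation `v_𝔭 : K → ℤ` attached to a prime `𝔭` of the ring of integers of `K`,
normalized so that a uniformizer has valuation `1`. Mathlib's `𝔭.valuation K` is multiplicative, with
`𝔭.valuation K x = exp (-v_𝔭(x))` for `x ≠ 0`. Only meaningful at `x ≠ 0` (the value at `0` is the
junk value `0`). -/
noncomputable def primeOrd {K : Type*} [Field K] [NumberField K]
    (𝔭 : HeightOneSpectrum (𝓞 K)) (x : K) : ℤ :=
  -WithZero.log (𝔭.valuation K x)

/-- For a finite extension `L / K` of number fields and a prime `𝔓` of `L`, the `𝔓`-adic valuation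
`v_𝔓 : L → ℚ`, normalized so that it extends the valuation `v_𝔭` of `K`, where `𝔭` is the prime of
`K` below `𝔓`: the normalized valuation of `𝔓` divided by the ramification index `e(𝔓 | 𝔭)`. -/
noncomputable def extendedOrd (K : Type*) {L : Type*} [Field K] [Field L] [NumberField L]
    [Algebra K L] (𝔓 : HeightOneSpectrum (𝓞 L)) (x : L) : ℚ :=
  (primeOrd 𝔓 x : ℚ) / (𝔓.asIdeal.ramificationIdx (𝓞 K) : ℚ)

/-- The trinomial `f(x) = x ^ d - b x ^ m`. -/
noncomputable def trinomialMap {K : Type*} [Field K] (d m : ℕ) (b : K) : K[X] :=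
  X ^ d - C b * X ^ m

/-- The `n`-th iterate `f ∘ f ∘ ⋯ ∘ f` of a polynomial `f`, with `f ^ 0 = x`. -/
noncomputable def polyIterate {K : Type*} [Field K] (f : K[X]) (n : ℕ) : K[X] :=
  f.comp^[n] X

/-- The fibre `f⁻ⁿ(y) = {γ ∈ Ω | fⁿ(γ) = y}` of the `n`-th iterate of `f`. -/
def iteratedFibre {K Ω : Type*} [Field K] [Field Ω] [Algebra K Ω] (f : K[X]) (n : ℕ) (y : Ω) :
    Set Ω :=
  {γ | aeval γ (polyIterate f n) = y}

/-- `K(α)` is a number field when `K` is one and `α` is algebraic over `K`. -/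
instance numberFieldAdjoinSimple {K Ω : Type*} [Field K] [NumberField K] [Field Ω] [Algebra K Ω]
    [Algebra.IsAlgebraic K Ω] (α : Ω) : NumberField K⟮α⟯ :=
  haveI : FiniteDimensional K K⟮α⟯ :=
    adjoin.finiteDimensional (Algebra.IsIntegral.isIntegral (R := K) α)
  NumberField.of_module_finite K K⟮α⟯

/-- The field `K(f⁻¹(α))` for a nonconstant `f ∈ K[x]`, as an extension of its subfield `K(α)`
(`α = f(γ) ∈ K(γ)` for every `γ ∈ f⁻¹(α)`, so that `K(α)(f⁻¹(α)) = K(f⁻¹(α))`). -/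
noncomputable abbrev fibreField {K Ω : Type*} [Field K] [Field Ω] [Algebra K Ω] (f : K[X]) (α : Ω) :
    IntermediateField K⟮α⟯ Ω :=
  adjoin K⟮α⟯ (iteratedFibre f 1 α)

/-! ### Additive valuations and the slopes of the trinomial. -/

section PrimeOrd

variable {K : Type*} [Field K] [NumberField K] (𝔭 : HeightOneSpectrum (𝓞 K))

/-! The Newton polygon of `x ^ d - b x ^ m - a` at a prime with `v(b) < min(v(a), 0)` has two
slopes: `m` roots have valuation `N / m > 0`, where `N = v(a) - v(b)`, and `d - m` roots have
valuation `v(b) / (d - m) < 0`. No completions are used: `primeOrd_root_dichotomy` gives the two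
possible valuations, and `sum_weights_eq` counts how often each occurs, from the total valuation and
the total degree.

Ramification: with `N` prime to `m`, the count over the primes of `F(γ)` above `P`, via the norm
formula `primeOrd_norm`, leaves a single prime `Q` on the first slope, with `e = m`
(`exists_prime_ramificationIdx_eq`). There `v_Q(γ) = N` and `v_Q(b) = m v_P(b)`, so the new
difference `N - m v_P(b)` is again positive and prime to `m`. Irreducibility makes each step of the
tower of degree `d`, and induction on `n` gives `e = m ^ n`.

Inertia (`inertia_action_trinomial`): a root `δ` of negative valuation has the valuation of some `c`
in the base field, because `d - m` divides `v(b)`. Since `d - m` is a unit, the derivative at `δ`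
has the least possible valuation, so `δ / c` differs by a unit from its other conjugates and inertia
fixes it. For the other `m` roots, the product over an inertia orbit lies in the inertia field, so
its valuation is a multiple of `e`. As each factor has valuation `e N / m`, the orbit size is a
multiple of `m`. Tameness is never needed. -/

lemma valuation_eq_exp_neg_primeOrd {x : K} (hx : x ≠ 0) :
    𝔭.valuation K x = WithZero.exp (-primeOrd 𝔭 x) := by
  rw [primeOrd, neg_neg, WithZero.exp_log]
  simpa using hx

lemma primeOrd_mul {x y : K} (hx : x ≠ 0) (hy : y ≠ 0) :
    primeOrd 𝔭 (x * y) = primeOrd 𝔭 x + primeOrd 𝔭 y := by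
  simp only [primeOrd, map_mul]
  rw [WithZero.log_mul (by simpa using hx) (by simpa using hy), neg_add]

lemma primeOrd_one : primeOrd 𝔭 (1 : K) = 0 := by
  simp [primeOrd]

lemma primeOrd_pow (x : K) (k : ℕ) : primeOrd 𝔭 (x ^ k) = k * primeOrd 𝔭 x := by
  simp [primeOrd, WithZero.log_pow]

lemma primeOrd_neg (x : K) : primeOrd 𝔭 (-x) = primeOrd 𝔭 x := by
  simp [primeOrd]

lemma primeOrd_inv (x : K) : primeOrd 𝔭 x⁻¹ = -primeOrd 𝔭 x := by
  simp [primeOrd, WithZero.log_inv]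

lemma primeOrd_div {x y : K} (hx : x ≠ 0) (hy : y ≠ 0) :
    primeOrd 𝔭 (x / y) = primeOrd 𝔭 x - primeOrd 𝔭 y := by
  rw [div_eq_mul_inv, primeOrd_mul 𝔭 hx (inv_ne_zero hy), primeOrd_inv, sub_eq_add_neg]

lemma primeOrd_prod {ι : Type*} (s : Finset ι) (g : ι → K) (hg : ∀ i ∈ s, g i ≠ 0) :
    primeOrd 𝔭 (∏ i ∈ s, g i) = ∑ i ∈ s, primeOrd 𝔭 (g i) := by
  classical
  induction s using Finset.induction_on with
  | empty => simp [primeOrd_one]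
  | insert i s hi ih =>
    have hs : ∀ j ∈ s, g j ≠ 0 := fun j hj ↦ hg j (Finset.mem_insert_of_mem hj)
    rw [Finset.prod_insert hi, Finset.sum_insert hi,
      primeOrd_mul 𝔭 (hg i (Finset.mem_insert_self i s)) (Finset.prod_ne_zero_iff.2 hs), ih hs]

lemma le_primeOrd_iff {x : K} (hx : x ≠ 0) (k : ℤ) :
    k ≤ primeOrd 𝔭 x ↔ 𝔭.valuation K x ≤ WithZero.exp (-k) := by
  rw [valuation_eq_exp_neg_primeOrd 𝔭 hx, WithZero.exp_le_exp, neg_le_neg_iff]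

/-- The sum must be nonzero because `primeOrd` takes the value `0`, not infinity, at `0`. -/
lemma le_primeOrd_add {x y : K} (hx : x ≠ 0) (hy : y ≠ 0) (hxy : x + y ≠ 0) {k : ℤ}
    (h₁ : k ≤ primeOrd 𝔭 x) (h₂ : k ≤ primeOrd 𝔭 y) : k ≤ primeOrd 𝔭 (x + y) := by
  rw [le_primeOrd_iff 𝔭 ‹_›] at *
  exact (𝔭.valuation K).map_add_le h₁ h₂

lemma min_le_primeOrd_add {x y : K} (hx : x ≠ 0) (hy : y ≠ 0) (hxy : x + y ≠ 0) :
    min (primeOrd 𝔭 x) (primeOrd 𝔭 y) ≤ primeOrd 𝔭 (x + y) :=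
  le_primeOrd_add 𝔭 hx hy hxy (min_le_left _ _) (min_le_right _ _)

lemma min_le_primeOrd_sub {x y : K} (hx : x ≠ 0) (hy : y ≠ 0) (hxy : x ≠ y) :
    min (primeOrd 𝔭 x) (primeOrd 𝔭 y) ≤ primeOrd 𝔭 (x - y) := by
  rw [sub_eq_add_neg, ← primeOrd_neg 𝔭 y]
  exact min_le_primeOrd_add 𝔭 hx (neg_ne_zero.2 hy) (by rwa [← sub_eq_add_neg, sub_ne_zero])

lemma primeOrd_add_eq_left {x y : K} (hx : x ≠ 0) (hy : y ≠ 0)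
    (h : primeOrd 𝔭 x < primeOrd 𝔭 y) : x + y ≠ 0 ∧ primeOrd 𝔭 (x + y) = primeOrd 𝔭 x := by
  have hxy : x + y ≠ 0 := by
    intro h0
    rw [eq_neg_of_add_eq_zero_left h0, primeOrd_neg] at h
    exact h.false
  refine ⟨hxy, le_antisymm ?_ ?_⟩
  · have := min_le_primeOrd_sub 𝔭 hxy hy (by simpa using hx)
    rw [add_sub_cancel_right] at this
    rcases min_le_iff.1 this with h' | h'
    · exact h'
    · exact absurd h' (not_le.2 h)
  · exact (le_min le_rfl h.le).trans (min_le_primeOrd_add 𝔭 hx hy hxy)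

lemma primeOrd_algebraMap_nonneg (r : 𝓞 K) : 0 ≤ primeOrd 𝔭 (algebraMap (𝓞 K) K r) := by
  rcases eq_or_ne r 0 with rfl | hr
  · simp [primeOrd]
  · rw [le_primeOrd_iff 𝔭 (by simpa using hr)]
    simpa using 𝔭.valuation_le_one r

lemma primeOrd_natCast_nonneg (k : ℕ) : 0 ≤ primeOrd 𝔭 (k : K) := by
  simpa using primeOrd_algebraMap_nonneg 𝔭 (k : 𝓞 K)

lemma primeOrd_algebraMap_pos_iff {r : 𝓞 K} (hr : r ≠ 0) :
    0 < primeOrd 𝔭 (algebraMap (𝓞 K) K r) ↔ r ∈ 𝔭.asIdeal := by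
  have hr' : algebraMap (𝓞 K) K r ≠ 0 := by simpa using hr
  rw [← HeightOneSpectrum.valuation_lt_one_iff_mem (K := K),
    valuation_eq_exp_neg_primeOrd 𝔭 hr', ← WithZero.exp_zero, WithZero.exp_lt_exp]
  simp

lemma primeOrd_algebraMap_eq_zero {r : 𝓞 K} (hr : r ∉ 𝔭.asIdeal) :
    primeOrd 𝔭 (algebraMap (𝓞 K) K r) = 0 := by
  have hr0 : r ≠ 0 := fun h ↦ hr (h ▸ zero_mem _)
  exact le_antisymm (not_lt.1 ((primeOrd_algebraMap_pos_iff 𝔭 hr0).not.2 hr))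
    (primeOrd_algebraMap_nonneg 𝔭 r)

lemma exists_primeOrd_eq (k : ℤ) : ∃ c : K, c ≠ 0 ∧ primeOrd 𝔭 c = k := by
  obtain ⟨c, hc⟩ := 𝔭.valuation_surjective K (WithZero.exp (-k))
  refine ⟨c, ?_, ?_⟩
  · rintro rfl
    rw [map_zero] at hc
    exact WithZero.exp_ne_zero hc.symm
  · simp [primeOrd, hc]

variable {L : Type*} [Field L] [NumberField L] [Algebra K L]

lemma primeOrd_algebraMap (𝔓 : HeightOneSpectrum (𝓞 L)) [𝔓.asIdeal.LiesOver 𝔭.asIdeal] (x : K) :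
    primeOrd 𝔓 (algebraMap K L x) = 𝔓.asIdeal.ramificationIdx (𝓞 K) * primeOrd 𝔭 x := by
  rw [primeOrd, ← HeightOneSpectrum.valuation_liesOver L 𝔭 𝔓,
    Ideal.ramificationIdx'_eq_ramificationIdx _ _ 𝔭.ne_bot, WithZero.log_pow, primeOrd]
  simp

/-- The two slopes of the Newton polygon of `x ^ d - b x ^ m - a`. -/
lemma primeOrd_root_dichotomy {d m : ℕ} (hm : 0 < m) (hmd : m < d) {a b γ : K} (ha : a ≠ 0)
    (hb : b ≠ 0) (hba : primeOrd 𝔭 b < primeOrd 𝔭 a) (hb0 : primeOrd 𝔭 b < 0)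
    (hγ : γ ^ d - b * γ ^ m = a) :
    γ ≠ 0 ∧ ((m : ℤ) * primeOrd 𝔭 γ = primeOrd 𝔭 a - primeOrd 𝔭 b ∨
      ((d : ℤ) - m) * primeOrd 𝔭 γ = primeOrd 𝔭 b) := by
  have hγ0 : γ ≠ 0 := by
    rintro rfl
    rw [zero_pow hm.ne', zero_pow (by lia), mul_zero, sub_zero] at hγ
    exact ha hγ.symm
  refine ⟨hγ0, ?_⟩
  have hx : γ ^ d ≠ 0 := pow_ne_zero _ hγ0
  have hy : b * γ ^ m ≠ 0 := mul_ne_zero hb (pow_ne_zero _ hγ0)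
  have ox : primeOrd 𝔭 (γ ^ d) = d * primeOrd 𝔭 γ := primeOrd_pow 𝔭 γ d
  have oy : primeOrd 𝔭 (b * γ ^ m) = primeOrd 𝔭 b + m * primeOrd 𝔭 γ := by
    rw [primeOrd_mul 𝔭 hb (pow_ne_zero _ hγ0), primeOrd_pow]
  -- Each of the three terms `γ ^ d`, `b γ ^ m`, `a` is bounded by the other two, so the least
  -- valuation is attained twice.
  have h₁ := min_le_primeOrd_sub 𝔭 hx hy (by rwa [← sub_ne_zero, hγ])
  have h₂ := min_le_primeOrd_add 𝔭 ha hy (by rwa [← hγ, sub_add_cancel])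
  have h₃ := min_le_primeOrd_sub 𝔭 hx ha (by rwa [← sub_ne_zero, ← hγ, sub_sub_cancel])
  rw [hγ, ox, oy] at h₁
  rw [← hγ, sub_add_cancel, hγ, ox, oy] at h₂
  rw [← hγ, sub_sub_cancel, hγ, ox, oy] at h₃
  have hdm : (0 : ℤ) < d - m := by lia
  have hm' : (0 : ℤ) < m := by lia
  rw [sub_mul]
  by_contra! hcon
  -- The only remaining tie is between `γ ^ d` and `a`. It forces `v(γ) > 0`, yet also `(d - m) v(γ)
  -- < v(b) < 0`.
  have hlt : (d : ℤ) * primeOrd 𝔭 γ = primeOrd 𝔭 a ∧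
      primeOrd 𝔭 a < primeOrd 𝔭 b + m * primeOrd 𝔭 γ := by
    generalize (d : ℤ) * primeOrd 𝔭 γ = u, (m : ℤ) * primeOrd 𝔭 γ = v at *
    omega
  have hpos : 0 < primeOrd 𝔭 γ := by
    by_contra! hneg
    have := mul_nonpos_of_nonneg_of_nonpos hm'.le hneg
    lia
  have := mul_pos hdm hpos
  lia

end PrimeOrd

/-! ### Primes above a given prime and the valuation of a norm. -/

section NormFormula

variable {K : Type*} (L : Type*) [Field K] [NumberField K] [Field L] [NumberField L] [Algebra K L]

lemma finite_setOf_liesOver (𝔭 : HeightOneSpectrum (𝓞 K)) :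
    {Q : HeightOneSpectrum (𝓞 L) | Q.asIdeal.LiesOver 𝔭.asIdeal}.Finite := by
  have := 𝔭.isMaximal
  refine Set.Finite.of_finite_image (f := HeightOneSpectrum.asIdeal)
    ((IsDedekindDomain.primesOver_finite 𝔭.asIdeal (𝓞 L)).subset ?_) ?_
  · rintro _ ⟨Q, hQ, rfl⟩
    exact ⟨Q.isPrime, hQ⟩
  · intro Q _ Q' _ h
    exact HeightOneSpectrum.ext h

/-- The primes of `L` above a prime of `K`. -/
noncomputable def primesAbove (𝔭 : HeightOneSpectrum (𝓞 K)) : Finset (HeightOneSpectrum (𝓞 L)) :=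
  (finite_setOf_liesOver L 𝔭).toFinset

variable {L}

lemma mem_primesAbove {𝔭 : HeightOneSpectrum (𝓞 K)} {Q : HeightOneSpectrum (𝓞 L)} :
    Q ∈ primesAbove L 𝔭 ↔ Q.asIdeal.LiesOver 𝔭.asIdeal := by
  simp [primesAbove]

variable (L) in
lemma sum_ramificationIdx_mul_inertiaDeg (𝔭 : HeightOneSpectrum (𝓞 K)) :
    ∑ Q ∈ primesAbove L 𝔭, Q.asIdeal.ramificationIdx (𝓞 K) * Q.asIdeal.inertiaDeg (𝓞 K) =
      Module.finrank K L := by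
  have := 𝔭.isMaximal
  have := (IsDedekindDomain.primesOver_finite 𝔭.asIdeal (𝓞 L)).fintype
  rw [IsFractionRing.finrank_eq (𝓞 K) K (𝓞 L) L,
    ← Ideal.sum_ramification_inertia_eq_finrank 𝔭.asIdeal (𝓞 L)]
  refine Finset.sum_bij' (fun Q hQ ↦ ⟨Q.asIdeal, Q.isPrime, mem_primesAbove.1 hQ⟩)
    (fun Q _ ↦ ⟨Q.1, Q.2.1, Ideal.ne_bot_of_mem_primesOver 𝔭.ne_bot Q.2⟩) ?_ ?_ ?_ ?_ ?_
  · simp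
  · intro Q _
    exact mem_primesAbove.2 Q.2.2
  · simp
  · simp
  · simp

open UniqueFactorizationMonoid in
/-- The exponent of `𝔭` in the relative norm of an ideal. -/
lemma count_relNorm (𝔭 : HeightOneSpectrum (𝓞 K)) {I : Ideal (𝓞 L)} (hI : I ≠ ⊥) :
    (normalizedFactors (Ideal.relNorm (𝓞 K) I)).count 𝔭.asIdeal =
      ∑ Q ∈ primesAbove L 𝔭,
        Q.asIdeal.inertiaDeg (𝓞 K) * (normalizedFactors I).count Q.asIdeal := by
  classical
  induction I using UniqueFactorizationMonoid.induction_on_prime with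
  | h₁ => exact absurd rfl hI
  | h₂ I h =>
    rw [Ideal.isUnit_iff] at h
    subst h
    simp only [← Ideal.one_eq_top, map_one, normalizedFactors_one, Multiset.count_zero,
      mul_zero, Finset.sum_const_zero]
  | h₃ I Q hI0 hQ ih =>
    have hQ0 := hQ.ne_zero
    have hQp : Q.IsPrime := Ideal.isPrime_of_prime hQ
    have hQm : Q.IsMaximal := hQp.isMaximal hQ0
    have hpm : (Q.under (𝓞 K)).IsMaximal := Ideal.IsMaximal.under (𝓞 K) Q
    have hp0 : Q.under (𝓞 K) ≠ ⊥ := by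
      intro h
      exact hQ0 (Ideal.eq_bot_of_comap_eq_bot h)
    have hpp : Prime (Q.under (𝓞 K)) := Ideal.prime_of_isPrime hp0 inferInstance
    have hN : Ideal.relNorm (𝓞 K) I ≠ 0 := by
      rwa [Ne, Ideal.zero_eq_bot, Ideal.relNorm_eq_bot_iff]
    -- The norm of a prime `Q` is the prime below it raised to the inertia degree.
    rw [map_mul, Ideal.relNorm_eq_pow_of_isMaximal Q (Q.under (𝓞 K)),
      normalizedFactors_mul (pow_ne_zero _ hp0) hN, Multiset.count_add, ih hI0,
      normalizedFactors_pow, Multiset.count_nsmul, normalizedFactors_irreducible hpp.irreducible,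
      normalizedFactors_mul hQ0 hI0, normalizedFactors_irreducible hQ.irreducible]
    simp only [normalize_eq, Multiset.count_add, mul_add, Finset.sum_add_distrib,
      Multiset.count_singleton]
    congr 1
    split_ifs with h
    · rw [Finset.sum_eq_single_of_mem (⟨Q, hQp, hQ0⟩ : HeightOneSpectrum (𝓞 L))]
      · simp
      · exact mem_primesAbove.2 ⟨h⟩
      · intro Q' _ hne
        rw [if_neg, mul_zero]
        rintro rfl
        exact hne rfl
    · rw [mul_zero, eq_comm]
      refine Finset.sum_eq_zero fun Q' hQ' ↦ ?_
      rw [if_neg, mul_zero]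
      rintro rfl
      exact h (mem_primesAbove.1 hQ').over

open UniqueFactorizationMonoid in
lemma primeOrd_eq_count (𝔭 : HeightOneSpectrum (𝓞 K)) {r : 𝓞 K} (hr : r ≠ 0) :
    primeOrd 𝔭 (algebraMap (𝓞 K) K r) =
      (normalizedFactors (Ideal.span {r})).count 𝔭.asIdeal := by
  classical
  have h0 : Ideal.span {r} ≠ ⊥ := by simpa using hr
  rw [primeOrd, HeightOneSpectrum.valuation_of_algebraMap,
    HeightOneSpectrum.intValuation_eq_exp_neg_multiplicity _ hr, WithZero.log_exp, neg_neg,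
    multiplicity_eq_of_emultiplicity_eq_some
      (emultiplicity_eq_count_normalizedFactors 𝔭.irreducible h0), normalize_eq]

/-- The valuation of a norm. -/
lemma primeOrd_norm (𝔭 : HeightOneSpectrum (𝓞 K)) {x : L} (hx : x ≠ 0) :
    primeOrd 𝔭 (Algebra.norm K x) =
      ∑ Q ∈ primesAbove L 𝔭, (Q.asIdeal.inertiaDeg (𝓞 K) : ℤ) * primeOrd Q x := by
  have key (r : 𝓞 L) (hr : r ≠ 0) : primeOrd 𝔭 (Algebra.norm K (algebraMap (𝓞 L) L r)) =
      ∑ Q ∈ primesAbove L 𝔭, (Q.asIdeal.inertiaDeg (𝓞 K) : ℤ) *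
        primeOrd Q (algebraMap (𝓞 L) L r) := by
    have hs : Ideal.span {r} ≠ ⊥ := by simpa using hr
    have hN : Algebra.intNorm (𝓞 K) (𝓞 L) r ≠ 0 := by simpa using hr
    rw [← Algebra.algebraMap_intNorm (A := 𝓞 K) (K := K) (L := L) (B := 𝓞 L),
      primeOrd_eq_count 𝔭 hN, ← Ideal.relNorm_singleton, count_relNorm 𝔭 hs]
    push_cast
    refine Finset.sum_congr rfl fun Q _ ↦ ?_
    rw [primeOrd_eq_count Q hr]
  obtain ⟨r, s, hs, rfl⟩ := IsFractionRing.div_surjective (A := 𝓞 L) x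
  have hs0 : s ≠ 0 := nonZeroDivisors.ne_zero hs
  have hr0 : r ≠ 0 := by
    rintro rfl
    simp at hx
  have hr' : algebraMap (𝓞 L) L r ≠ 0 := by simpa using hr0
  have hs' : algebraMap (𝓞 L) L s ≠ 0 := by simpa using hs0
  have hdiv : Algebra.norm K (algebraMap (𝓞 L) L r / algebraMap (𝓞 L) L s) =
      Algebra.norm K (algebraMap (𝓞 L) L r) / Algebra.norm K (algebraMap (𝓞 L) L s) := by
    rw [eq_div_iff (by simpa using hs0), ← map_mul, div_mul_cancel₀ _ hs']
  rw [hdiv, primeOrd_div 𝔭 (by simpa using hr0) (by simpa using hs0), key r hr0, key s hs0,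
    ← Finset.sum_sub_distrib]
  refine Finset.sum_congr rfl fun Q _ ↦ ?_
  rw [primeOrd_div Q hr' hs', mul_sub]

end NormFormula

/-! ### Counting on the first slope; a prime of ramification index `m`. -/

section TotallyRamified

/-- The total weight of the indices on the first slope of a two-slope Newton polygon. -/
lemma sum_weights_eq {ι : Type*} (s : Finset ι) (p : ι → Prop) [DecidablePred p] (e f w : ι → ℤ)
    {d m u v : ℤ} (hm : 0 < m) (hmd : m < d) (hv : v < 0) (hvu : v < u)
    (hw : ∑ i ∈ s, f i * w i = u) (he : ∑ i ∈ s, e i * f i = d)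
    (h₁ : ∀ i ∈ s, p i → m * w i = e i * (u - v))
    (h₂ : ∀ i ∈ s, ¬ p i → (d - m) * w i = e i * v) :
    ∑ i ∈ s with p i, e i * f i = m := by
  rw [← Finset.sum_filter_add_sum_filter_not s p] at hw he
  have e₁ : m * ∑ i ∈ s with p i, f i * w i = (u - v) * ∑ i ∈ s with p i, e i * f i := by
    rw [Finset.mul_sum, Finset.mul_sum]
    refine Finset.sum_congr rfl fun i hi ↦ ?_
    rw [Finset.mem_filter] at hi
    linear_combination f i * h₁ i hi.1 hi.2
  have e₂ : (d - m) * ∑ i ∈ s with ¬ p i, f i * w i = v * ∑ i ∈ s with ¬ p i, e i * f i := by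
    rw [Finset.mul_sum, Finset.mul_sum]
    refine Finset.sum_congr rfl fun i hi ↦ ?_
    rw [Finset.mem_filter] at hi
    linear_combination f i * h₂ i hi.1 hi.2
  generalize ∑ i ∈ s with p i, f i * w i = W₁ at *
  generalize ∑ i ∈ s with ¬ p i, f i * w i = W₂ at *
  generalize ∑ i ∈ s with p i, e i * f i = A at *
  generalize ∑ i ∈ s with ¬ p i, e i * f i = B at *
  have hpos : 0 < (d - m) * (u - v) - m * v := by nlinarith
  -- Eliminating `W₁`, `W₂` and `B` from the four linear relations leaves one equation for `A`.
  have : (A - m) * ((d - m) * (u - v) - m * v) = 0 := by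
    linear_combination (m * (d - m)) * hw - (d - m) * e₁ - m * e₂ - m * v * he
  rcases mul_eq_zero.1 this with h | h <;> lia

lemma trinomial_monic {F : Type*} [Field F] {d m : ℕ} (hmd : m < d) (a b : F) :
    (X ^ d - C b * X ^ m - C a : F[X]).Monic ∧
      (X ^ d - C b * X ^ m - C a : F[X]).natDegree = d := by
  have hd : (C b * X ^ m + C a : F[X]).degree < d := by
    refine (degree_add_le _ _).trans_lt (max_lt ?_ ?_)
    · exact (degree_C_mul_X_pow_le m b).trans_lt (by exact_mod_cast hmd)
    · exact degree_C_le.trans_lt (by exact_mod_cast (Nat.zero_le m).trans_lt hmd)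
  rw [sub_sub]
  exact ⟨monic_X_pow_sub hd, 
    natDegree_eq_of_degree_eq_some ((degree_sub_eq_left_of_degree_lt (by simpa using hd)).trans
      (degree_X_pow d))⟩

variable {F L : Type*} [Field F] [Field L] [Algebra F L]

lemma minpoly_eq_trinomial {d m : ℕ} (hmd : m < d) {a b : F} {γ : L}
    (hγ : γ ^ d - algebraMap F L b * γ ^ m = algebraMap F L a)
    (hdeg : (minpoly F γ).natDegree = d) :
    minpoly F γ = X ^ d - C b * X ^ m - C a := by
  obtain ⟨hmon, hnat⟩ := trinomial_monic hmd a b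
  have hint : IsIntegral F γ := ⟨_, hmon, by simp [← hγ, eval₂_eq_eval_map]⟩
  refine (eq_of_monic_of_dvd_of_natDegree_le (minpoly.monic hint) hmon ?_ ?_).symm
  · exact minpoly.dvd F γ (by simp [hγ])
  · rw [hdeg, hnat]

/-- The degrees force `L = F(γ)`, so the norm is the constant term of the minimal polynomial up to
sign. -/
lemma norm_root_trinomial [FiniteDimensional F L] {d m : ℕ} (hm : 0 < m) (hmd : m < d) {a b : F}
    {γ : L} (hγ : γ ^ d - algebraMap F L b * γ ^ m = algebraMap F L a)
    (hdeg : (minpoly F γ).natDegree = d) (hfin : Module.finrank F L = d) :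
    Algebra.norm F γ = (-1) ^ d * -a := by
  have hint : IsIntegral F γ := Algebra.IsIntegral.isIntegral γ
  have h1 : Module.finrank F⟮γ⟯ L = 1 := by
    have := Module.finrank_mul_finrank F F⟮γ⟯ L
    rw [adjoin.finrank hint, hdeg, hfin] at this
    exact Nat.eq_of_mul_eq_mul_left (by lia) (this.trans (mul_one d).symm)
  have h2 := Algebra.PowerBasis.norm_gen_eq_coeff_zero_minpoly (adjoin.powerBasis hint)
  rw [adjoin.powerBasis_gen, adjoin.powerBasis_dim, minpoly_gen, hdeg,
    minpoly_eq_trinomial hmd hγ hdeg] at h2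
  rw [Algebra.norm_eq_norm_adjoin, h1, pow_one, h2]
  simp [coeff_X_pow, hm.ne, (hm.trans hmd).ne]

/-- A root of `x ^ d - b x ^ m - a` of degree `d` generates an extension with a prime of
ramification index `m` when the Newton polygon has a slope of exact denominator `m`. -/
lemma exists_prime_ramificationIdx_eq [NumberField F] [NumberField L] {d m : ℕ} (hm : 0 < m)
    (hmd : m < d) (P : HeightOneSpectrum (𝓞 F)) {a b : F} (ha : a ≠ 0) (hb : b ≠ 0)
    (hba : primeOrd P b < primeOrd P a) (hb0 : primeOrd P b < 0)
    (hcop : IsCoprime (m : ℤ) (primeOrd P a - primeOrd P b)) {γ : L}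
    (hγ : γ ^ d - algebraMap F L b * γ ^ m = algebraMap F L a)
    (hdeg : (minpoly F γ).natDegree = d) (hfin : Module.finrank F L = d) :
    ∃ Q : HeightOneSpectrum (𝓞 L), Q.asIdeal.LiesOver P.asIdeal ∧
      Q.asIdeal.ramificationIdx (𝓞 F) = m ∧
      primeOrd Q γ = primeOrd P a - primeOrd P b := by
  classical
  have ha' : algebraMap F L a ≠ 0 := by simpa using ha
  have hb' : algebraMap F L b ≠ 0 := by simpa using hb
  have hpos (Q : HeightOneSpectrum (𝓞 L)) : 0 < Q.asIdeal.ramificationIdx (𝓞 F) :=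
    have := Q.isPrime
    Ideal.ramificationIdx_pos _ _
  have hfpos (Q : HeightOneSpectrum (𝓞 L)) : 0 < Q.asIdeal.inertiaDeg (𝓞 F) :=
    have := Q.isPrime
    Ideal.inertiaDeg_pos _ _
  have hdich (Q : HeightOneSpectrum (𝓞 L)) (hQ : Q ∈ primesAbove L P) :
      γ ≠ 0 ∧ ((m : ℤ) * primeOrd Q γ =
          Q.asIdeal.ramificationIdx (𝓞 F) * (primeOrd P a - primeOrd P b) ∨
        ((d : ℤ) - m) * primeOrd Q γ = Q.asIdeal.ramificationIdx (𝓞 F) * primeOrd P b) := by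
    have := mem_primesAbove.1 hQ
    have he : (0 : ℤ) < Q.asIdeal.ramificationIdx (𝓞 F) := by exact_mod_cast hpos Q
    have := primeOrd_root_dichotomy Q hm hmd ha' hb'
      (by rw [primeOrd_algebraMap P, primeOrd_algebraMap P]; gcongr)
      (by rw [primeOrd_algebraMap P]; exact mul_neg_of_pos_of_neg he hb0) hγ
    rwa [primeOrd_algebraMap P, primeOrd_algebraMap P, ← mul_sub] at this
  have hγ0 : γ ≠ 0 := by
    rintro rfl
    rw [zero_pow hm.ne', zero_pow (by lia), mul_zero, sub_zero] at hγ
    exact ha' hγ.symm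
  have hsum := sum_weights_eq (primesAbove L P)
    (fun Q ↦ (m : ℤ) * primeOrd Q γ =
      Q.asIdeal.ramificationIdx (𝓞 F) * (primeOrd P a - primeOrd P b))
    (fun Q ↦ Q.asIdeal.ramificationIdx (𝓞 F)) (fun Q ↦ Q.asIdeal.inertiaDeg (𝓞 F))
    (fun Q ↦ primeOrd Q γ) (d := d) (m := m) (by exact_mod_cast hm) (by exact_mod_cast hmd) hb0 hba
    (by
      rw [← primeOrd_norm P hγ0, norm_root_trinomial hm hmd hγ hdeg hfin, primeOrd_mul P
        (by simp) (neg_ne_zero.2 ha), primeOrd_pow, primeOrd_neg, primeOrd_neg, primeOrd_one,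
        mul_zero, zero_add])
    (by rw [← hfin]; exact_mod_cast sum_ramificationIdx_mul_inertiaDeg L P)
    (fun Q _ h ↦ h) (fun Q hQ h ↦ (hdich Q hQ).2.resolve_left h)
  obtain ⟨Q, hQs⟩ : (Finset.filter (fun Q ↦ (m : ℤ) * primeOrd Q γ =
      Q.asIdeal.ramificationIdx (𝓞 F) * (primeOrd P a - primeOrd P b))
        (primesAbove L P)).Nonempty := by
    by_contra hne
    rw [Finset.not_nonempty_iff_eq_empty] at hne
    rw [hne, Finset.sum_empty] at hsum
    lia
  obtain ⟨hQ, hQm⟩ := Finset.mem_filter.1 hQs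
  have hle : (Q.asIdeal.ramificationIdx (𝓞 F) : ℤ) * Q.asIdeal.inertiaDeg (𝓞 F) ≤ m := by
    rw [← hsum]
    exact Finset.single_le_sum (f := fun Q : HeightOneSpectrum (𝓞 L) ↦
      (Q.asIdeal.ramificationIdx (𝓞 F) : ℤ) * Q.asIdeal.inertiaDeg (𝓞 F))
      (fun _ _ ↦ by positivity) hQs
  -- From `m v_Q(γ) = e N` with `N` prime to `m`. Together with `e f ≤ m` this pins down `e = m`.
  have hdvd : (m : ℤ) ∣ Q.asIdeal.ramificationIdx (𝓞 F) :=
    hcop.dvd_of_dvd_mul_right ⟨_, hQm.symm⟩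
  have heq : Q.asIdeal.ramificationIdx (𝓞 F) = m := by
    refine le_antisymm ?_ (Nat.le_of_dvd (hpos Q) (by exact_mod_cast hdvd))
    exact (Nat.le_mul_of_pos_right _ (hfpos Q)).trans (by exact_mod_cast hle)
  refine ⟨Q, mem_primesAbove.1 hQ, heq, ?_⟩
  rw [heq] at hQm
  exact mul_left_cancel₀ (by exact_mod_cast hm.ne') hQm

end TotallyRamified

/-! ### Inertia groups and inertia fields. -/

section Inertia

variable {F M : Type*} [Field F] [Field M] [NumberField M] [Algebra F M]

/-- Inertia acts trivially on the residue field of the localisation. -/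
lemma primeOrd_sub_pos_of_mem_inertia {Q : HeightOneSpectrum (𝓞 M)} {σ : Gal(M/F)}
    (hσ : σ ∈ Q.asIdeal.inertia Gal(M/F)) {y : M} (hy0 : y ≠ 0) (hy : 0 ≤ primeOrd Q y)
    (hne : σ y ≠ y) : 0 < primeOrd Q (σ y - y) := by
  have hval : Q.valuation M y ≤ 1 := by
    rw [valuation_eq_exp_neg_primeOrd Q hy0, ← WithZero.exp_zero, WithZero.exp_le_exp]
    lia
  obtain ⟨r, ⟨s, hs⟩, h⟩ := HeightOneSpectrum.exists_primeCompl_mul_eq_of_integer Q y hval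
  have hs' : s ∉ Q.asIdeal := hs
  have hmem (x : 𝓞 M) : σ • x - x ∈ Q.asIdeal := hσ x
  have hσs : σ • s ∉ Q.asIdeal := fun h ↦ hs' (by simpa using Q.asIdeal.sub_mem h (hmem s))
  have hs0 : algebraMap (𝓞 M) M s ≠ 0 := by
    intro h0
    rw [FaithfulSMul.algebraMap_eq_zero_iff] at h0
    exact hs' (h0 ▸ Q.asIdeal.zero_mem)
  have hσs0 : algebraMap (𝓞 M) M (σ • s) ≠ 0 := by
    intro h0
    rw [FaithfulSMul.algebraMap_eq_zero_iff] at h0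
    exact hσs (h0 ▸ Q.asIdeal.zero_mem)
  have hσh : σ y * algebraMap (𝓞 M) M (σ • s) = algebraMap (𝓞 M) M (σ • r) := by
    change σ y * σ (algebraMap (𝓞 M) M s) = σ (algebraMap (𝓞 M) M r)
    rw [← map_mul, h]
  -- The quotient rule for `y = r / s` with `s` and `σ s` outside `Q`.
  have hprod : (σ y - y) * algebraMap (𝓞 M) M (σ • s) * algebraMap (𝓞 M) M s =
      algebraMap (𝓞 M) M ((σ • r - r) * s - r * (σ • s - s)) := by
    simp only [map_sub, map_mul]
    linear_combination algebraMap (𝓞 M) M s * hσh - algebraMap (𝓞 M) M (σ • s) * h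
  have hy' : σ y - y ≠ 0 := sub_ne_zero.2 hne
  have hn0 : (σ • r - r) * s - r * (σ • s - s) ≠ 0 := by
    intro h0
    rw [h0, map_zero] at hprod
    exact mul_ne_zero (mul_ne_zero hy' hσs0) hs0 hprod
  have hpos := (primeOrd_algebraMap_pos_iff Q hn0).2
    (Q.asIdeal.sub_mem (Q.asIdeal.mul_mem_right _ (hmem r)) (Q.asIdeal.mul_mem_left _ (hmem s)))
  rwa [← hprod, primeOrd_mul Q (mul_ne_zero hy' hσs0) hs0, primeOrd_mul Q hy' hσs0,
    primeOrd_algebraMap_eq_zero Q hs', primeOrd_algebraMap_eq_zero Q hσs, add_zero, add_zero]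
    at hpos

lemma card_inertia_eq_ramificationIdx [NumberField F] {G : Type*} [Group G] [Finite G] [MulSemiringAction G (𝓞 M)]
    [IsGaloisGroup G (𝓞 F) (𝓞 M)] (Q : HeightOneSpectrum (𝓞 M)) :
    Nat.card (Q.asIdeal.inertia G) = Q.asIdeal.ramificationIdx (𝓞 F) := by
  have := Q.isMaximal
  have : (Q.asIdeal.under (𝓞 F)).IsMaximal := Ideal.IsMaximal.under (𝓞 F) Q.asIdeal
  have : Q.asIdeal.under (𝓞 F) ≠ ⊥ := fun h ↦ Q.ne_bot (Ideal.eq_bot_of_comap_eq_bot h)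
  have : Finite (𝓞 F ⧸ Q.asIdeal.under (𝓞 F)) := Ring.HasFiniteQuotients.finiteQuotient this
  rw [Ideal.card_inertia_eq_ramificationIdxIn (Q.asIdeal.under (𝓞 F)) Q.asIdeal,
    Ideal.ramificationIdxIn_eq_ramificationIdx _ Q.asIdeal G]

/-- The valuation of an element of the inertia field is divisible by the ramification index. -/
lemma ramificationIdx_dvd_primeOrd_of_fixed [NumberField F] [IsGalois F M] (Q : HeightOneSpectrum (𝓞 M)) {z : M}
    (hz : ∀ σ ∈ Q.asIdeal.inertia Gal(M/F), σ z = z) :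
    (Q.asIdeal.ramificationIdx (𝓞 F) : ℤ) ∣ primeOrd Q z := by
  let I := Q.asIdeal.inertia Gal(M/F)
  let E : IntermediateField F M := FixedPoints.intermediateField I
  have : NumberField E := .of_intermediateField E
  have : IsGaloisGroup I E M := IsGaloisGroup.subgroup Gal(M/F) F M I
  have : IsGaloisGroup I (𝓞 E) (𝓞 M) := .of_isFractionRing I (𝓞 E) (𝓞 M) E M
  have : IsGaloisGroup Gal(M/F) (𝓞 F) (𝓞 M) := .of_isFractionRing _ (𝓞 F) (𝓞 M) F M
  have hcard : Q.asIdeal.ramificationIdx (𝓞 E) = Q.asIdeal.ramificationIdx (𝓞 F) := by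
    rw [← card_inertia_eq_ramificationIdx (G := I), ← card_inertia_eq_ramificationIdx
      (G := Gal(M/F))]
    -- Over the inertia field `E` the whole Galois group is inertia, so all the ramification of `Q`
    -- over `F` already occurs in `M / E`.
    have htop : Q.asIdeal.inertia I = ⊤ := by
      rw [eq_top_iff]
      intro σ _
      exact Ideal.coe_mem_inertia.1 σ.2
    rw [htop, Subgroup.card_top]
  have hE0 : Q.asIdeal.under (𝓞 E) ≠ ⊥ := fun h ↦ Q.ne_bot (Ideal.eq_bot_of_comap_eq_bot h)
  have := Q.isPrime
  let q : HeightOneSpectrum (𝓞 E) := ⟨Q.asIdeal.under (𝓞 E), inferInstance, hE0⟩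
  have : Q.asIdeal.LiesOver q.asIdeal := ⟨rfl⟩
  have hzE : z ∈ E := fun σ ↦ hz σ.1 σ.2
  have := primeOrd_algebraMap q Q (⟨z, hzE⟩ : E)
  rw [hcard] at this
  exact ⟨_, this⟩

end Inertia

/-! ### Derivatives and distances between roots. -/

section Roots

lemma mul_eval_derivative_trinomial {R : Type*} [CommRing R] {d m : ℕ} (hm : 0 < m) (hmd : m < d)
    (a b δ : R) : δ * (derivative (X ^ d - C b * X ^ m - C a)).eval δ =
      d * δ ^ d - m * (b * δ ^ m) := by
  obtain ⟨d, rfl⟩ := Nat.exists_eq_succ_of_ne_zero (hm.trans hmd).ne'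
  obtain ⟨m, rfl⟩ := Nat.exists_eq_succ_of_ne_zero hm.ne'
  simp only [derivative_sub, derivative_C_mul, derivative_X_pow, derivative_C, eval_sub, eval_mul,
    eval_C, eval_pow, eval_X, eval_zero, Nat.succ_eq_add_one, Nat.add_sub_cancel]
  ring

lemma exists_finset_eq_prod_X_sub_C {M : Type*} [Field M] {f : M[X]} (hf : f.Splits)
    (hmon : f.Monic) (hsep : ∀ γ, f.IsRoot γ → (derivative f).eval γ ≠ 0) :
    ∃ R : Finset M, f = ∏ γ ∈ R, (X - C γ) := by
  classical
  have hnodup : f.roots.Nodup := by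
    rw [Multiset.nodup_iff_count_le_one]
    intro γ
    rw [count_roots]
    by_contra! h
    exact hsep γ (one_lt_rootMultiplicity_iff_isRoot hmon.ne_zero |>.1 h).1
      (one_lt_rootMultiplicity_iff_isRoot hmon.ne_zero |>.1 h).2
  exact ⟨⟨f.roots, hnodup⟩, hf.eq_prod_roots_of_monic hmon⟩

lemma eval_derivative_prod_X_sub_C {M : Type*} [Field M] [DecidableEq M] {R : Finset M} {δ : M}
    (hδ : δ ∈ R) :
    (derivative (∏ γ ∈ R, (X - C γ))).eval δ = ∏ γ ∈ R.erase δ, (δ - γ) :=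
  eval_multiset_prod_X_sub_C_derivative hδ

variable {M : Type*} [Field M] [NumberField M] (Q : HeightOneSpectrum (𝓞 M)) {d m : ℕ} {a b : M}

/-- The derivative of `x ^ d - b x ^ m - a` at a root of negative valuation. -/
lemma primeOrd_derivative_of_neg (hm : 0 < m) (hmd : m < d) (ha : a ≠ 0) (hb : b ≠ 0)
    (hba : primeOrd Q b < primeOrd Q a) (hdm : primeOrd Q ((d : M) - m) = 0) {δ : M} (hδ0 : δ ≠ 0)
    (hδ : δ ^ d - b * δ ^ m = a) (hneg : primeOrd Q δ < 0)
    (hord : ((d : ℤ) - m) * primeOrd Q δ = primeOrd Q b) :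
    (derivative (X ^ d - C b * X ^ m - C a)).eval δ ≠ 0 ∧
      primeOrd Q ((derivative (X ^ d - C b * X ^ m - C a)).eval δ) =
        ((d : ℤ) - 1) * primeOrd Q δ := by
  have hd0 : (d : M) ≠ 0 := by exact_mod_cast (hm.trans hmd).ne'
  have hdm0 : (d : M) - m ≠ 0 := sub_ne_zero.2 (by exact_mod_cast hmd.ne')
  have hbδ : b * δ ^ m ≠ 0 := mul_ne_zero hb (pow_ne_zero _ hδ0)
  have hm' : (m : ℤ) * primeOrd Q δ < 0 := mul_neg_of_pos_of_neg (by exact_mod_cast hm) hneg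
  have e₁ : primeOrd Q (((d : M) - m) * (b * δ ^ m)) = d * primeOrd Q δ := by
    rw [primeOrd_mul Q hdm0 hbδ, primeOrd_mul Q hb (pow_ne_zero _ hδ0), primeOrd_pow, hdm, ← hord]
    ring
  have e₂ : primeOrd Q b < primeOrd Q (d * a) := by
    rw [primeOrd_mul Q hd0 ha]
    have := primeOrd_natCast_nonneg Q d
    lia
  have e₃ : (d : ℤ) * primeOrd Q δ < primeOrd Q (d * a) := by
    rw [sub_mul] at hord
    lia
  obtain ⟨h0, hs⟩ := primeOrd_add_eq_left Q (mul_ne_zero hdm0 hbδ) (mul_ne_zero hd0 ha)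
    (by rwa [e₁])
  -- Substituting `δ ^ d = b δ ^ m + a` isolates the dominant term `(d - m) b δ ^ m`.
  have hD : ((d : M) - m) * (b * δ ^ m) + d * a =
      δ * (derivative (X ^ d - C b * X ^ m - C a)).eval δ := by
    rw [mul_eval_derivative_trinomial hm hmd]
    linear_combination -(d : M) * hδ
  rw [hD] at h0 hs
  have hD0 := right_ne_zero_of_mul h0
  refine ⟨hD0, ?_⟩
  rw [primeOrd_mul Q hδ0 hD0, e₁] at hs
  linarith

/-- If `δ ∈ R` has the least valuation `t` in `R` and the derivative of `∏ (X - γ)` at `δ` has the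
least possible valuation, then all differences `δ - γ` have valuation `t`. -/
lemma primeOrd_sub_root_eq {R : Finset M} {t : ℤ} (hR0 : ∀ γ ∈ R, γ ≠ 0)
    (ht : ∀ γ ∈ R, t ≤ primeOrd Q γ) {δ : M} (hδ : δ ∈ R)
    (hD : primeOrd Q ((derivative (∏ γ ∈ R, (X - C γ))).eval δ) = ((R.card : ℤ) - 1) * t)
    {γ : M} (hγ : γ ∈ R) (hne : γ ≠ δ) : primeOrd Q (δ - γ) = t := by
  classical
  have hsub (γ) (hγ : γ ∈ R.erase δ) : δ - γ ≠ 0 := sub_ne_zero.2 (Finset.ne_of_mem_erase hγ).symm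
  have hle (γ) (hγ : γ ∈ R.erase δ) : t ≤ primeOrd Q (δ - γ) := by
    have hγR := Finset.mem_of_mem_erase hγ
    exact (le_min (ht δ hδ) (ht γ hγR)).trans
      (min_le_primeOrd_sub Q (hR0 δ hδ) (hR0 γ hγR) (Finset.ne_of_mem_erase hγ).symm)
  rw [eval_derivative_prod_X_sub_C hδ, primeOrd_prod Q _ _ hsub] at hD
  -- Each summand is at least `t` and the totals agree, so every summand equals `t`.
  have hconst : ∑ _γ ∈ R.erase δ, t = ∑ γ ∈ R.erase δ, primeOrd Q (δ - γ) := by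
    rw [hD, Finset.sum_const, Finset.card_erase_of_mem hδ, nsmul_eq_mul,
      Nat.cast_sub (Finset.card_pos.2 ⟨δ, hδ⟩), Nat.cast_one]
  exact ((Finset.sum_eq_sum_iff_of_le hle).1 hconst γ (Finset.mem_erase.2 ⟨hne, hγ⟩)).symm

end Roots

/-! ### Simplicity of the roots of positive valuation. -/

section RootsOverBase

variable {F M : Type*} [Field F] [Field M] [NumberField F] [NumberField M] [Algebra F M]
  {P : HeightOneSpectrum (𝓞 F)} {Q : HeightOneSpectrum (𝓞 M)} [Q.asIdeal.LiesOver P.asIdeal]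
  {d m : ℕ} {a b : F}

/-- The derivative of `x ^ d - b x ^ m - a` does not vanish at a root of positive valuation. -/
lemma eval_derivative_ne_zero_of_pos (hm : 0 < m) (hmd : m < d) (hb : b ≠ 0)
    (hb0 : primeOrd P b < 0) (hcop : IsCoprime (m : ℤ) (primeOrd P a - primeOrd P b))
    (hdm : primeOrd P ((d : F) - m) = 0) {γ : M} (hγ0 : γ ≠ 0) (hpos : 0 < primeOrd Q γ)
    (hord : (m : ℤ) * primeOrd Q γ =
      Q.asIdeal.ramificationIdx (𝓞 F) * (primeOrd P a - primeOrd P b)) :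
    (derivative (X ^ d - C (algebraMap F M b) * X ^ m - C (algebraMap F M a))).eval γ ≠ 0 := by
  intro h0
  have := Q.isPrime
  have he : (0 : ℤ) < Q.asIdeal.ramificationIdx (𝓞 F) := by
    exact_mod_cast Ideal.ramificationIdx_pos _ _
  have hb' : algebraMap F M b ≠ 0 := by simpa using hb
  have hd0 : (d : M) ≠ 0 := by exact_mod_cast (hm.trans hmd).ne'
  have hm0 : (m : M) ≠ 0 := by exact_mod_cast hm.ne'
  have h := mul_eval_derivative_trinomial hm hmd (algebraMap F M a) (algebraMap F M b) γ
  rw [h0, mul_zero, eq_comm, sub_eq_zero] at h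
  apply_fun primeOrd Q at h
  rw [primeOrd_mul Q hd0 (pow_ne_zero _ hγ0), primeOrd_mul Q hm0 (mul_ne_zero hb'
    (pow_ne_zero _ hγ0)), primeOrd_mul Q hb' (pow_ne_zero _ hγ0), primeOrd_pow, primeOrd_pow,
    primeOrd_algebraMap P, ← map_natCast (algebraMap F M), ← map_natCast (algebraMap F M),
    primeOrd_algebraMap P, primeOrd_algebraMap P] at h
  set e : ℤ := (Q.asIdeal.ramificationIdx (𝓞 F) : ℤ)
  -- A zero derivative means `d γ ^ d = m b γ ^ m`. Comparing valuations with `m v(γ) = e N` gives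
  -- `m ∣ (d - m) N`.
  have hdvd : (m : ℤ) ∣ (d : ℤ) - m := by
    refine hcop.dvd_of_dvd_mul_right
      ⟨primeOrd P (m : F) + primeOrd P b - primeOrd P (d : F), mul_left_cancel₀ he.ne' ?_⟩
    linear_combination (m : ℤ) * h - ((d : ℤ) - m) * hord
  -- Now `m` divides the `P`-unit `d - m`, so it is a unit at `P` too. Then `(d - m) v(γ) + v(d) =
  -- v(b)` has a positive left side and a negative right side.
  have hmP : primeOrd P (m : F) = 0 := by
    obtain ⟨k, hk⟩ := hdvd
    lift k to ℕ using by nlinarith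
    have hk' : (d : F) - m = m * k := by exact_mod_cast congrArg (Int.cast (R := F)) hk
    have hk0 : (k : F) ≠ 0 := by
      rintro h0
      rw [h0, mul_zero, sub_eq_zero] at hk'
      exact hmd.ne' (by exact_mod_cast hk')
    rw [hk', primeOrd_mul P (by exact_mod_cast hm.ne') hk0] at hdm
    have := primeOrd_natCast_nonneg P m
    have := primeOrd_natCast_nonneg P k
    lia
  have h₁ : 0 ≤ e * primeOrd P (d : F) := mul_nonneg he.le (primeOrd_natCast_nonneg P d)
  have h₂ : 0 < ((d : ℤ) - m) * primeOrd Q γ := mul_pos (by lia) hpos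
  have h₃ : e * primeOrd P b < 0 := mul_neg_of_pos_of_neg he hb0
  rw [hmP] at h
  linarith

end RootsOverBase

/-! ### The inertia action on the roots. -/

section InertiaAction

variable {F M : Type*} [Field F] [Field M] [NumberField F] [NumberField M] [Algebra F M]
  {P : HeightOneSpectrum (𝓞 F)} {Q : HeightOneSpectrum (𝓞 M)} [Q.asIdeal.LiesOver P.asIdeal]
  {d m : ℕ} {a b : F}

omit [NumberField F] in
/-- The inertia group fixes an element `δ` that has the valuation of an element of the base field
and is not too close to `σ δ`. -/
lemma inertia_fixes {σ : Gal(M/F)} (hσ : σ ∈ Q.asIdeal.inertia Gal(M/F)) {δ : M} (hδ0 : δ ≠ 0)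
    {c : F} (hc0 : c ≠ 0) (hc : primeOrd Q (algebraMap F M c) = primeOrd Q δ)
    (hfar : σ δ ≠ δ → primeOrd Q (δ - σ δ) = primeOrd Q δ) : σ δ = δ := by
  by_contra hne
  have hc' : algebraMap F M c ≠ 0 := by simpa using hc0
  have hy : σ (δ / algebraMap F M c) = σ δ / algebraMap F M c := by simp
  have hne' : σ (δ / algebraMap F M c) ≠ δ / algebraMap F M c := by
    rw [hy]
    exact fun h ↦ hne (by rwa [div_left_inj' hc'] at h)
  have h := primeOrd_sub_pos_of_mem_inertia hσ (div_ne_zero hδ0 hc')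
    (by rw [primeOrd_div Q hδ0 hc', hc, sub_self]) hne'
  rw [hy, ← sub_div, primeOrd_div Q (sub_ne_zero.2 hne) hc', hc, ← neg_sub δ, primeOrd_neg,
    hfar hne, sub_self] at h
  exact h.false

/-- An inertia-stable set of `m` elements whose valuations have exact denominator `m` is permuted
transitively. -/
lemma inertia_transitive [IsGalois F M] {S : Finset M} {N : ℤ} (hcard : S.card = m)
    (hcop : IsCoprime (m : ℤ) N) (hS0 : ∀ γ ∈ S, γ ≠ 0)
    (hord : ∀ γ ∈ S, (m : ℤ) * primeOrd Q γ = Q.asIdeal.ramificationIdx (𝓞 F) * N)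
    (hstab : ∀ σ ∈ Q.asIdeal.inertia Gal(M/F), ∀ γ ∈ S, σ γ ∈ S) {γ δ : M} (hγ : γ ∈ S)
    (hδ : δ ∈ S) : ∃ σ ∈ Q.asIdeal.inertia Gal(M/F), σ γ = δ := by
  classical
  have := Q.isPrime
  have he : (0 : ℤ) < Q.asIdeal.ramificationIdx (𝓞 F) := by
    exact_mod_cast Ideal.ramificationIdx_pos _ _
  let O : Finset M := S.filter fun δ ↦ ∃ σ ∈ Q.asIdeal.inertia Gal(M/F), σ γ = δ
  have hOS : O ⊆ S := Finset.filter_subset _ _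
  have hγO : γ ∈ O := Finset.mem_filter.2 ⟨hγ, 1, one_mem _, rfl⟩
  have hfix : ∀ σ ∈ Q.asIdeal.inertia Gal(M/F), σ (∏ r ∈ O, r) = ∏ r ∈ O, r := by
    intro σ hσ
    have himage : O.image σ = O := by
      refine Finset.eq_of_subset_of_card_le ?_ (Finset.card_image_of_injective _ σ.injective).ge
      intro x hx
      obtain ⟨y, hy, rfl⟩ := Finset.mem_image.1 hx
      obtain ⟨hyS, τ, hτ, rfl⟩ := Finset.mem_filter.1 hy
      exact Finset.mem_filter.2 ⟨hstab σ hσ _ hyS, σ * τ, mul_mem hσ hτ, rfl⟩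
    rw [map_prod, ← Finset.prod_image (f := fun x ↦ x) (fun x _ y _ h ↦ σ.injective h), himage]
  -- The product over the orbit `O` lies in the inertia field.
  have hdvd := ramificationIdx_dvd_primeOrd_of_fixed Q hfix
  rw [primeOrd_prod Q _ _ fun r hr ↦ hS0 r (hOS hr)] at hdvd
  have hsum : (m : ℤ) * ∑ r ∈ O, primeOrd Q r =
      O.card * (Q.asIdeal.ramificationIdx (𝓞 F) * N) := by
    rw [Finset.mul_sum, Finset.sum_congr rfl fun r hr ↦ hord r (hOS hr), Finset.sum_const,
      nsmul_eq_mul]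
  have hm : (m : ℤ) ∣ O.card := by
    refine hcop.dvd_of_dvd_mul_right ?_
    obtain ⟨k, hk⟩ := hdvd
    refine ⟨k, mul_left_cancel₀ he.ne' ?_⟩
    rw [hk] at hsum
    linear_combination -hsum
  have hle : m ≤ O.card := Nat.le_of_dvd (Finset.card_pos.2 ⟨γ, hγO⟩) (by exact_mod_cast hm)
  have hO : O = S := Finset.eq_of_subset_of_card_le hOS (hcard.trans_le hle)
  rw [← hO] at hδ
  exact (Finset.mem_filter.1 hδ).2

/-- The action of the inertia group on the roots of `x ^ d - b x ^ m - a`. -/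
theorem inertia_action_trinomial [IsGalois F M] (hm : 0 < m) (hmd : m < d) (ha : a ≠ 0)
    (hb : b ≠ 0) (hba : primeOrd P b < primeOrd P a) (hb0 : primeOrd P b < 0)
    (hdvd : (d : ℤ) - m ∣ primeOrd P b)
    (hcop : IsCoprime (m : ℤ) (primeOrd P a - primeOrd P b))
    (hdm : primeOrd P ((d : F) - m) = 0)
    (hsplit : (X ^ d - C (algebraMap F M b) * X ^ m - C (algebraMap F M a) : M[X]).Splits) :
    ∃ S T : Set M, S ∪ T = {γ | γ ^ d - algebraMap F M b * γ ^ m = algebraMap F M a} ∧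
      Disjoint S T ∧ S.ncard = m ∧ T.ncard = d - m ∧
      (∀ σ ∈ Q.asIdeal.inertia Gal(M/F), ∀ γ ∈ S, σ γ ∈ S) ∧
      (∀ γ ∈ S, ∀ δ ∈ S, ∃ σ ∈ Q.asIdeal.inertia Gal(M/F), σ γ = δ) ∧
      (∀ σ ∈ Q.asIdeal.inertia Gal(M/F), ∀ γ ∈ T, σ γ = γ) := by
  classical
  have := Q.isPrime
  have he : (0 : ℤ) < Q.asIdeal.ramificationIdx (𝓞 F) := by
    exact_mod_cast Ideal.ramificationIdx_pos _ _
  have ha' : algebraMap F M a ≠ 0 := by simpa using ha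
  have hb' : algebraMap F M b ≠ 0 := by simpa using hb
  have hmZ : (0 : ℤ) < m := by exact_mod_cast hm
  have hmdZ : (0 : ℤ) < (d : ℤ) - m := by lia
  have oa := primeOrd_algebraMap P Q a
  have ob := primeOrd_algebraMap P Q b
  have hbaQ : primeOrd Q (algebraMap F M b) < primeOrd Q (algebraMap F M a) := by
    rw [oa, ob]; gcongr
  have hb0Q : primeOrd Q (algebraMap F M b) < 0 := by
    rw [ob]; exact mul_neg_of_pos_of_neg he hb0
  have hdmQ : primeOrd Q ((d : M) - m) = 0 := by
    have := primeOrd_algebraMap P Q ((d : F) - m)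
    rwa [hdm, mul_zero, map_sub, map_natCast, map_natCast] at this
  have hdich (γ : M) (hγ : γ ^ d - algebraMap F M b * γ ^ m = algebraMap F M a) :
      γ ≠ 0 ∧ (((m : ℤ) * primeOrd Q γ = Q.asIdeal.ramificationIdx (𝓞 F) *
          (primeOrd P a - primeOrd P b) ∧ 0 < primeOrd Q γ) ∨
        (((d : ℤ) - m) * primeOrd Q γ = primeOrd Q (algebraMap F M b) ∧ primeOrd Q γ < 0)) := by
    obtain ⟨h0, h⟩ := primeOrd_root_dichotomy Q hm hmd ha' hb' hbaQ hb0Q hγ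
    refine ⟨h0, h.imp (fun h ↦ ⟨?_, ?_⟩) fun h ↦ ⟨h, ?_⟩⟩
    · rw [h, oa, ob, mul_sub]
    · exact pos_of_mul_pos_right (h ▸ sub_pos.2 hbaQ) hmZ.le
    · exact neg_of_mul_neg_right (h ▸ hb0Q) hmdZ.le
  obtain ⟨hmon, hnat⟩ := trinomial_monic hmd (algebraMap F M a) (algebraMap F M b)
  have hroot (γ : M) : (X ^ d - C (algebraMap F M b) * X ^ m - C (algebraMap F M a)).IsRoot γ ↔
      γ ^ d - algebraMap F M b * γ ^ m = algebraMap F M a := by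
    simp [IsRoot, sub_eq_zero]
  obtain ⟨R, hR⟩ := exists_finset_eq_prod_X_sub_C hsplit hmon fun γ hγ ↦ by
    rw [hroot] at hγ
    obtain ⟨h0, ⟨h, hpos⟩ | ⟨h, hneg⟩⟩ := hdich γ hγ
    · exact eval_derivative_ne_zero_of_pos hm hmd hb hb0 hcop hdm h0 hpos h
    · exact (primeOrd_derivative_of_neg Q hm hmd ha' hb' hbaQ hdmQ h0 hγ hneg h).1
  have hmem (γ : M) : γ ∈ R ↔ γ ^ d - algebraMap F M b * γ ^ m = algebraMap F M a := by
    rw [← hroot, hR, IsRoot, eval_prod, Finset.prod_eq_zero_iff]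
    simp [sub_eq_zero]
  have hR0 : ∀ γ ∈ R, γ ≠ 0 := fun γ hγ ↦ (hdich γ ((hmem γ).1 hγ)).1
  have hcard : R.card = d := by
    rw [← hnat, hR, natDegree_finsetProd_X_sub_C_eq_card]
  -- The constant term is the product of the roots up to sign. The factor `1` matches the weights in
  -- `sum_weights_eq`.
  have hsum : ∑ γ ∈ R, (1 : ℤ) * primeOrd Q γ = primeOrd Q (algebraMap F M a) := by
    have h := congrArg (eval 0) hR
    simp only [eval_prod, eval_sub, eval_X, eval_C, eval_mul, eval_pow, zero_pow hm.ne',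
      zero_pow (hm.trans hmd).ne', zero_sub, mul_zero, neg_zero] at h
    rw [← primeOrd_neg Q (algebraMap F M a), h,
      primeOrd_prod Q R _ fun γ hγ ↦ neg_ne_zero.2 (hR0 γ hγ)]
    simp only [one_mul, primeOrd_neg]
  have hScard : (R.filter fun γ ↦ 0 < primeOrd Q γ).card = m := by
    have := sum_weights_eq R (fun γ ↦ 0 < primeOrd Q γ) (fun _ ↦ 1) (fun _ ↦ 1) (primeOrd Q)
      hmZ (by lia : (m : ℤ) < d) hb0Q hbaQ hsum (by simp [hcard])
      (fun γ hγ hpos ↦ by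
        obtain ⟨-, ⟨h, -⟩ | ⟨-, hneg⟩⟩ := hdich γ ((hmem γ).1 hγ)
        · rw [h, oa, ob, one_mul, mul_sub]
        · exact absurd hpos hneg.not_gt)
      (fun γ hγ hpos ↦ by
        obtain ⟨-, ⟨-, h⟩ | ⟨h, -⟩⟩ := hdich γ ((hmem γ).1 hγ)
        · exact absurd h hpos
        · rw [h, one_mul])
    simpa using this
  have hfix : ∀ σ ∈ Q.asIdeal.inertia Gal(M/F), ∀ δ ∈ R, ¬ 0 < primeOrd Q δ → σ δ = δ := by
    intro σ hσ δ hδ hnpos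
    obtain ⟨-, ⟨-, h⟩ | ⟨h, hneg⟩⟩ := hdich δ ((hmem δ).1 hδ)
    · exact absurd h hnpos
    have hD := primeOrd_derivative_of_neg Q hm hmd ha' hb' hbaQ hdmQ (hR0 δ hδ) ((hmem δ).1 hδ)
      hneg h
    rw [hR] at hD
    obtain ⟨k, hk⟩ := hdvd
    obtain ⟨c, hc0, hc⟩ := exists_primeOrd_eq P k
    have hct : primeOrd Q (algebraMap F M c) = primeOrd Q δ := by
      rw [primeOrd_algebraMap P, hc]
      refine mul_left_cancel₀ hmdZ.ne' ?_
      rw [h, ob, hk]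
      ring
    refine inertia_fixes hσ (hR0 δ hδ) hc0 hct fun hne ↦ ?_
    have hσδ : σ δ ∈ R := by
      have h := congrArg σ ((hmem δ).1 hδ)
      rw [hmem]
      simpa using h
    refine primeOrd_sub_root_eq Q hR0 (fun γ hγ ↦ ?_) hδ (by rw [hD.2, hcard]) hσδ hne
    obtain ⟨-, ⟨-, hγ⟩ | ⟨hγ, -⟩⟩ := hdich γ ((hmem γ).1 hγ)
    · lia
    · exact (mul_left_cancel₀ hmdZ.ne' (h.trans hγ.symm)).le
  have hstab : ∀ σ ∈ Q.asIdeal.inertia Gal(M/F), ∀ γ ∈ R.filter (fun γ ↦ 0 < primeOrd Q γ),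
      σ γ ∈ R.filter fun γ ↦ 0 < primeOrd Q γ := by
    intro σ hσ γ hγ
    obtain ⟨hγR, hγ⟩ := Finset.mem_filter.1 hγ
    have hσγ : σ γ ∈ R := by
      have h := congrArg σ ((hmem γ).1 hγR)
      rw [hmem]
      simpa using h
    refine Finset.mem_filter.2 ⟨hσγ, ?_⟩
    by_contra hcon
    -- Otherwise `σ` fixes `σ γ`, so `σ γ = γ`, whose valuation is positive.
    have := σ.injective (hfix σ hσ _ hσγ hcon)
    rw [this] at hcon
    exact hcon hγ
  refine ⟨R.filter fun γ ↦ 0 < primeOrd Q γ, R.filter fun γ ↦ ¬ 0 < primeOrd Q γ, ?_, ?_, ?_, ?_,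
    hstab, ?_, ?_⟩
  · rw [← Finset.coe_union, Finset.filter_union_filter_not_eq]
    ext γ
    simp [hmem]
  · rw [Finset.disjoint_coe]
    exact Finset.disjoint_filter_filter_not _ _ _
  · rw [Set.ncard_coe_finset, hScard]
  · rw [Set.ncard_coe_finset]
    have := Finset.card_filter_add_card_filter_not (s := R) fun γ ↦ 0 < primeOrd Q γ
    lia
  · intro γ hγ δ hδ
    refine inertia_transitive hScard hcop (fun r hr ↦ hR0 r (Finset.mem_filter.1 hr).1) ?_ hstab
      hγ hδ
    intro r hr
    obtain ⟨hrR, hr⟩ := Finset.mem_filter.1 hr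
    obtain ⟨-, ⟨h, -⟩ | ⟨-, hneg⟩⟩ := hdich r ((hmem r).1 hrR)
    · exact h
    · exact absurd hr hneg.not_gt
  · intro σ hσ γ hγ
    obtain ⟨hγR, hγ⟩ := Finset.mem_filter.1 hγ
    exact hfix σ hσ γ hγR hγ

end InertiaAction

/-! ### One step of the tower. -/

section Tower

lemma exists_mem_primesAbove {K : Type*} (L : Type*) [Field K] [NumberField K] [Field L]
    [NumberField L] [Algebra K L] (𝔭 : HeightOneSpectrum (𝓞 K)) :
    ∃ 𝔓 : HeightOneSpectrum (𝓞 L), 𝔓.asIdeal.LiesOver 𝔭.asIdeal ∧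
      𝔓.asIdeal.ramificationIdx (𝓞 K) ≤ Module.finrank K L := by
  have hsum := sum_ramificationIdx_mul_inertiaDeg L 𝔭
  obtain ⟨𝔓, h𝔓⟩ : (primesAbove L 𝔭).Nonempty := by
    by_contra hne
    rw [Finset.not_nonempty_iff_eq_empty.1 hne, Finset.sum_empty] at hsum
    exact Module.finrank_pos.ne hsum
  refine ⟨𝔓, mem_primesAbove.1 h𝔓, ?_⟩
  have := 𝔓.isPrime
  rw [← hsum]
  exact (Nat.le_mul_of_pos_right _ (Ideal.inertiaDeg_pos _ _)).trans
    (Finset.single_le_sum (f := fun Q : HeightOneSpectrum (𝓞 L) ↦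
      Q.asIdeal.ramificationIdx (𝓞 K) * Q.asIdeal.inertiaDeg (𝓞 K)) (fun _ _ ↦ Nat.zero_le _) h𝔓)

/-- `𝔓` has ramification index `m ^ n` over `𝔭` and the valuation of `α / b` at `𝔓` is positive and
prime to `m`. -/
structure IsRamifiedAt {K L : Type*} [Field K] [NumberField K] [Field L] [NumberField L]
    [Algebra K L] (𝔭 : HeightOneSpectrum (𝓞 K)) (m n : ℕ) (b : K) (α : L)
    (𝔓 : HeightOneSpectrum (𝓞 L)) : Prop where
  liesOver : 𝔓.asIdeal.LiesOver 𝔭.asIdeal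
  ramificationIdx_eq : 𝔓.asIdeal.ramificationIdx (𝓞 K) = m ^ n
  ne_zero : α ≠ 0
  primeOrd_lt : primeOrd 𝔓 (algebraMap K L b) < primeOrd 𝔓 α
  isCoprime : IsCoprime (m : ℤ) (primeOrd 𝔓 α - primeOrd 𝔓 (algebraMap K L b))

variable {K F L : Type*} [Field K] [NumberField K] [Field F] [NumberField F] [Field L]
  [NumberField L] [Algebra K F] [Algebra F L] [Algebra K L] [IsScalarTower K F L]

lemma IsRamifiedAt.exists_above {𝔭 : HeightOneSpectrum (𝓞 K)} {d m n : ℕ} {b : K} {β : F}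
    {P : HeightOneSpectrum (𝓞 F)} (hP : IsRamifiedAt 𝔭 m n b β P) (hm : 0 < m) (hmd : m < d)
    (hb : b ≠ 0) (hb0 : primeOrd 𝔭 b < 0) {γ : L}
    (hγ : γ ^ d - algebraMap K L b * γ ^ m = algebraMap F L β) (htop : K⟮γ⟯ = ⊤)
    (hfin : Module.finrank F L = d) :
    ∃ Q : HeightOneSpectrum (𝓞 L), IsRamifiedAt 𝔭 m (n + 1) b γ Q := by
  obtain ⟨hover, hram, hβ0, hlt, hcop⟩ := hP
  have hb' : algebraMap K F b ≠ 0 := by simpa using hb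
  have hint : IsIntegral F γ := Algebra.IsIntegral.isIntegral γ
  have htop' : F⟮γ⟯ = ⊤ := by
    rw [← restrictScalars_eq_top_iff (K := K), eq_top_iff, ← htop, adjoin_simple_le_iff]
    exact mem_adjoin_simple_self F γ
  have hdeg : (minpoly F γ).natDegree = d := by
    rw [← adjoin.finrank hint, htop', finrank_top', hfin]
  have hbF : primeOrd P (algebraMap K F b) < 0 := by
    rw [primeOrd_algebraMap 𝔭, hram]
    exact mul_neg_of_pos_of_neg (by positivity) hb0
  rw [IsScalarTower.algebraMap_apply K F L] at hγ
  obtain ⟨Q, hQP, he, hord⟩ := exists_prime_ramificationIdx_eq hm hmd P hβ0 hb' hlt hbF hcop hγ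
    hdeg hfin
  have hbL : primeOrd Q (algebraMap K L b) = m * primeOrd P (algebraMap K F b) := by
    rw [IsScalarTower.algebraMap_apply K F L, primeOrd_algebraMap P, he]
  have hbneg : (m : ℤ) * primeOrd P (algebraMap K F b) < 0 :=
    mul_neg_of_pos_of_neg (by exact_mod_cast hm) hbF
  refine ⟨Q, .trans Q.asIdeal P.asIdeal 𝔭.asIdeal, ?_, ?_, ?_, ?_⟩
  · rw [Ideal.ramificationIdx_tower (R := 𝓞 K) P.asIdeal Q.asIdeal, hram, he, pow_succ]
  · rintro rfl
    rw [zero_pow hm.ne', zero_pow (hm.trans hmd).ne', mul_zero, sub_zero, eq_comm] at hγ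
    exact hβ0 (by simpa using hγ)
  · rw [hord, hbL]
    lia
  · rw [hord, hbL, sub_eq_add_neg _ ((m : ℤ) * _), ← mul_neg]
    -- The new difference is the old one minus `m v_P(b)`, unchanged modulo `m`.
    exact hcop.add_mul_left_right _

end Tower

/-! ### Iterates, irreducibility and degrees. -/

section Iterate

variable {K : Type*} [Field K]

/-- Putting the extra `f` innermost shows that `f(α)` lies in the fibre one level down. -/
lemma polyIterate_succ (f : K[X]) (n : ℕ) :
    polyIterate f (n + 1) = (polyIterate f n).comp f := by
  induction n with
  | zero => simp [polyIterate]
  | succ n ih =>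
    have h (k : ℕ) : polyIterate f (k + 1) = f.comp (polyIterate f k) :=
      Function.iterate_succ_apply' _ _ _
    rw [h (n + 1), ih, ← comp_assoc, ← h n, ih]

lemma natDegree_polyIterate (f : K[X]) (n : ℕ) :
    (polyIterate f n).natDegree = f.natDegree ^ n := by
  rw [polyIterate, natDegree_iterate_comp, natDegree_X, mul_one]

/-- A factorisation of `g` composes to one of `g ∘ f`, and composing with a nonconstant `f`
multiplies degrees, hence reflects units. This passes irreducibility down the tower. -/
lemma irreducible_of_comp {f g : K[X]} (hf : f.natDegree ≠ 0) (h : Irreducible (g.comp f)) :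
    Irreducible g := by
  have key {p : K[X]} (hp : IsUnit (p.comp f)) : IsUnit p := by
    rw [isUnit_iff_degree_eq_zero] at hp ⊢
    have h0 : p ≠ 0 := by
      rintro rfl
      simp at hp
    have := natDegree_eq_zero_iff_degree_le_zero.2 hp.le
    rw [natDegree_comp, mul_eq_zero] at this
    rw [degree_eq_natDegree h0, this.resolve_right hf, Nat.cast_zero]
  refine ⟨fun hg ↦ h.not_isUnit ?_, fun p q hpq ↦ ?_⟩
  · exact hg.map (compRingHom f)
  · subst hpq
    rw [mul_comp] at h
    exact (h.isUnit_or_isUnit rfl).imp key key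

lemma natDegree_trinomialMap {d m : ℕ} (hmd : m < d) (b : K) :
    (trinomialMap d m b).natDegree = d := by
  have := (trinomial_monic hmd 0 b).2
  rwa [C_0, sub_zero] at this

variable {Ω : Type*} [Field Ω] [Algebra K Ω]

lemma finrank_adjoin_iteratedFibre {f : K[X]} {n : ℕ} {x₀ : K} {α : Ω}
    (hirr : Irreducible (polyIterate f n - C x₀))
    (hα : α ∈ iteratedFibre f n (algebraMap K Ω x₀)) :
    Module.finrank K K⟮α⟯ = f.natDegree ^ n := by
  have hroot : aeval α (polyIterate f n - C x₀) = 0 := by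
    rw [map_sub, aeval_C, sub_eq_zero]
    exact hα
  have hint : IsIntegral K α := (isAlgebraic_iff_isIntegral).1 ⟨_, hirr.ne_zero, hroot⟩
  rw [adjoin.finrank hint, ← minpoly.eq_of_irreducible hirr hroot,
    natDegree_mul_C (by simpa using hirr.ne_zero), natDegree_sub_C, natDegree_polyIterate]

end Iterate

/-! ### Induction on `n`. -/

section Main

variable {K Ω : Type*} [Field K] [NumberField K] [Field Ω] [Algebra K Ω]
    [Algebra.IsAlgebraic K Ω]

lemma exists_isRamifiedAt {d m : ℕ} (hm : 0 < m) (hmd : m < d) {b x₀ : K} (hx₀ : x₀ ≠ 0)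
    (hb : b ≠ 0) (𝔭 : HeightOneSpectrum (𝓞 K)) (hb0 : primeOrd 𝔭 b < 0)
    (hbx : primeOrd 𝔭 b < primeOrd 𝔭 x₀)
    (hcop : IsCoprime (m : ℤ) (primeOrd 𝔭 x₀ - primeOrd 𝔭 b)) (n : ℕ)
    (hirr : Irreducible (polyIterate (trinomialMap d m b) n - C x₀))
    (α : Ω) (hα : α ∈ iteratedFibre (trinomialMap d m b) n (algebraMap K Ω x₀)) :
    ∃ 𝔓 : HeightOneSpectrum (𝓞 K⟮α⟯), IsRamifiedAt 𝔭 m n b (AdjoinSimple.gen K α) 𝔓 := by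
  have hdeg := natDegree_trinomialMap hmd b
  have hd0 : (trinomialMap d m b).natDegree ≠ 0 := by lia
  induction n generalizing α with
  | zero =>
    have hfin := finrank_adjoin_iteratedFibre hirr hα
    rw [pow_zero] at hfin
    obtain ⟨𝔓, hover, hle⟩ := exists_mem_primesAbove K⟮α⟯ 𝔭
    have hα' : α = algebraMap K Ω x₀ := by simpa [iteratedFibre, polyIterate] using hα
    have hgen : AdjoinSimple.gen K α = algebraMap K K⟮α⟯ x₀ := Subtype.ext hα'
    have := 𝔓.isPrime
    have he : 𝔓.asIdeal.ramificationIdx (𝓞 K) = 1 :=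
      le_antisymm (hle.trans hfin.le) (Ideal.ramificationIdx_pos _ _)
    refine ⟨𝔓, hover, he, ?_, ?_, ?_⟩
    · rw [hgen]
      simpa using hx₀
    · rwa [hgen, primeOrd_algebraMap 𝔭, primeOrd_algebraMap 𝔭, he, Nat.cast_one, one_mul, one_mul]
    · rwa [hgen, primeOrd_algebraMap 𝔭, primeOrd_algebraMap 𝔭, he, Nat.cast_one, one_mul, one_mul]
  | succ n ih =>
    have hfinα := finrank_adjoin_iteratedFibre hirr hα
    have hirr' : Irreducible (polyIterate (trinomialMap d m b) n - C x₀) := by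
      refine irreducible_of_comp hd0 ?_
      rwa [sub_comp, C_comp, ← polyIterate_succ]
    set β : Ω := aeval α (trinomialMap d m b) with hβ
    have hβf : β ∈ iteratedFibre (trinomialMap d m b) n (algebraMap K Ω x₀) := by
      rw [iteratedFibre, Set.mem_ofPred_eq, hβ, ← aeval_comp, ← polyIterate_succ]
      exact hα
    have hfinβ := finrank_adjoin_iteratedFibre hirr' hβf
    obtain ⟨P, hP⟩ := ih hirr' β hβf
    have hle : K⟮β⟯ ≤ K⟮α⟯ := by
      rw [adjoin_simple_le_iff]
      have h := aeval_algebraMap_apply Ω (AdjoinSimple.gen K α) (trinomialMap d m b)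
      rw [AdjoinSimple.algebraMap_gen] at h
      rw [hβ, h]
      exact SetLike.coe_mem _
    let _ : Algebra K⟮β⟯ K⟮α⟯ := (inclusion hle).toAlgebra
    have : IsScalarTower K K⟮β⟯ K⟮α⟯ := .of_algebraMap_eq fun x ↦ rfl
    refine hP.exists_above hm hmd hb hb0 ?_ ?_ ?_
    · apply Subtype.ext
      change α ^ d - algebraMap K Ω b * α ^ m = β
      simp [hβ, trinomialMap]
    · have hint := Algebra.IsIntegral.isIntegral (R := K) (AdjoinSimple.gen K α)
      refine eq_of_le_of_finrank_eq le_top ?_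
      rw [finrank_top', adjoin.finrank hint, minpoly_gen,
        adjoin.finrank (Algebra.IsIntegral.isIntegral α)]
    -- The degrees over `K` are `d ^ (n + 1)` and `d ^ n`, so the relative degree is `d`.
    · have := Module.finrank_mul_finrank K K⟮β⟯ K⟮α⟯
      rw [hfinα, hfinβ, hdeg, pow_succ] at this
      exact Nat.eq_of_mul_eq_mul_left (by have := hm.trans hmd; positivity) this

end Main

/-! ### Assembly of the theorem. -/

theorem lemma2p3 {K Ω : Type*} [Field K] [NumberField K] [Field Ω] [Algebra K Ω]
    [IsAlgClosed Ω] [Algebra.IsAlgebraic K Ω]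
    (d m : ℕ) (hm : 2 ≤ m) (hmd : m < d) (b x₀ : K) (hx₀ : x₀ ≠ 0)
    (𝔭 : HeightOneSpectrum (𝓞 K))
    (hdm : (d : 𝓞 K) - (m : 𝓞 K) ∉ 𝔭.asIdeal)
    (hb : primeOrd 𝔭 b < min (primeOrd 𝔭 x₀) 0)
    (hdvd : (d : ℤ) - (m : ℤ) ∣ primeOrd 𝔭 b)
    (hgcd : Int.gcd (m : ℤ) (primeOrd 𝔭 (x₀ / b)) = 1)
    (n : ℕ)
    (hirr : Irreducible (polyIterate (trinomialMap d m b) n - C x₀))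
    (α : Ω) (hα : α ∈ iteratedFibre (trinomialMap d m b) n (algebraMap K Ω x₀)) :
    ∃ (𝔓 : HeightOneSpectrum (𝓞 K⟮α⟯))
      (𝔔 : HeightOneSpectrum (𝓞 (fibreField (trinomialMap d m b) α))),
      𝔓.asIdeal.LiesOver 𝔭.asIdeal ∧
      𝔓.asIdeal.ramificationIdx (𝓞 K) = m ^ n ∧
      (∃ N : ℕ, 0 < N ∧ N.Coprime m ∧
        (m : ℚ) ^ n *
          extendedOrd K 𝔓 (AdjoinSimple.gen K α / algebraMap K K⟮α⟯ b) = N) ∧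
      𝔔.asIdeal.LiesOver 𝔓.asIdeal ∧
      -- the `d` roots of `f(x) - α` split into a set `S` of `m` roots, permuted transitively by
      -- the inertia group, and the `d - m` remaining ones, each of which it fixes
      ∃ S T : Set (fibreField (trinomialMap d m b) α),
        S ∪ T = Subtype.val ⁻¹' iteratedFibre (trinomialMap d m b) 1 α ∧ Disjoint S T ∧
        S.ncard = m ∧ T.ncard = d - m ∧
        (∀ σ ∈ 𝔔.asIdeal.inertia Gal(fibreField (trinomialMap d m b) α/K⟮α⟯), ∀ γ ∈ S, σ γ ∈ S) ∧
        (∀ γ ∈ S, ∀ δ ∈ S,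
          ∃ σ ∈ 𝔔.asIdeal.inertia Gal(fibreField (trinomialMap d m b) α/K⟮α⟯), σ γ = δ) ∧
        (∀ σ ∈ 𝔔.asIdeal.inertia Gal(fibreField (trinomialMap d m b) α/K⟮α⟯), ∀ γ ∈ T, σ γ = γ) := by
  have hm0 : 0 < m := by lia
  obtain ⟨hbx, hb0⟩ := lt_min_iff.1 hb
  have hb' : b ≠ 0 := by
    rintro rfl
    simp [primeOrd] at hb0
  rw [primeOrd_div 𝔭 hx₀ hb', ← Int.isCoprime_iff_gcd_eq_one] at hgcd
  obtain ⟨𝔓, hover, hram, hα0, hlt, hcop⟩ :=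
    exists_isRamifiedAt hm0 hmd hx₀ hb' 𝔭 hb0 hbx hgcd n hirr α hα
  have hbα : algebraMap K K⟮α⟯ b ≠ 0 := by simpa using hb'
  have hord := primeOrd_algebraMap 𝔭 𝔓 b
  set g : K⟮α⟯[X] := X ^ d - C (algebraMap K K⟮α⟯ b) * X ^ m - C (AdjoinSimple.gen K α) with hg
  have hg0 : g ≠ 0 := (trinomial_monic hmd _ _).1.ne_zero
  have hfib : iteratedFibre (trinomialMap d m b) 1 α = g.rootSet Ω := by
    ext γ
    rw [mem_rootSet_of_ne hg0]
    simp [iteratedFibre, polyIterate, trinomialMap, hg, sub_eq_zero,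
      ← IsScalarTower.algebraMap_apply K K⟮α⟯ Ω]
  have hsplitting : g.IsSplittingField K⟮α⟯ (fibreField (trinomialMap d m b) α) := by
    rw [fibreField, hfib]
    exact adjoin_rootSet_isSplittingField (IsAlgClosed.splits _)
  have : FiniteDimensional K⟮α⟯ (fibreField (trinomialMap d m b) α) :=
    IsSplittingField.finiteDimensional _ g
  have : NumberField (fibreField (trinomialMap d m b) α) :=
    NumberField.of_module_finite K⟮α⟯ _
  have : Normal K⟮α⟯ (fibreField (trinomialMap d m b) α) := Normal.of_isSplittingField g
  have : IsGalois K⟮α⟯ (fibreField (trinomialMap d m b) α) := ⟨⟩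
  -- Any prime above `𝔓` will do.
  obtain ⟨𝔔, hQ, -⟩ := exists_mem_primesAbove (fibreField (trinomialMap d m b) α) 𝔓
  refine ⟨𝔓, 𝔔, hover, hram, ?_, hQ, ?_⟩
  -- The factor `m ^ n` cancels the ramification index in `extendedOrd`, leaving the normalized
  -- valuation of `α / b`.
  · refine ⟨(primeOrd 𝔓 (AdjoinSimple.gen K α) - primeOrd 𝔓 (algebraMap K K⟮α⟯ b)).toNat,
      by lia, ?_, ?_⟩
    · rw [← Nat.isCoprime_iff_coprime, Int.toNat_of_nonneg (by lia)]
      exact hcop.symm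
    · have hm' : (m : ℚ) ≠ 0 := by exact_mod_cast hm0.ne'
      rw [extendedOrd, hram, primeOrd_div 𝔓 hα0 hbα, Nat.cast_pow,
        mul_div_cancel₀ _ (pow_ne_zero _ hm')]
      exact_mod_cast (Int.toNat_of_nonneg (by lia)).symm
  · obtain ⟨S, T, hST, h⟩ := inertia_action_trinomial (P := 𝔓) (Q := 𝔔) hm0 hmd hα0 hbα hlt
      (by rw [hord, hram]; exact mul_neg_of_pos_of_neg (by positivity) hb0)
      (by rw [hord]; exact hdvd.mul_left _) hcop
      (by
        have h := primeOrd_algebraMap 𝔭 𝔓 (algebraMap (𝓞 K) K (d - m))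
        rw [primeOrd_algebraMap_eq_zero 𝔭 hdm, mul_zero] at h
        simpa using h)
      (by
        have := hsplitting.splits
        simpa [hg] using this)
    refine ⟨S, T, ?_, h⟩
    rw [hST]
    ext γ
    rw [Set.mem_preimage, hfib, mem_rootSet_of_ne hg0, Set.mem_ofPred_eq, ← Subtype.coe_inj]
    simp [hg, sub_eq_zero]
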